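/- Let $\mathcal H$ and $\mathcal H'$ be complex Hilbert spaces of the same finite dimension $d\ge 1$, and let $n\ge 0$ be an integer. For $\pi\in\mathcal S_n$ let $U_\pi$ be the unitary on $\mathcal H^{\otimes n}$ given, in terms of an orthonormal basis $|1\rangle,\dots,|d\rangle$ of $\mathcal H$, by $U_\pi|j_1\rangle\otimes\cdots\otimes|j_n\rangle=|j_{\pi(1)}\rangle\otimes\cdots\otimes|j_{\pi(n)}\rangle$. Let $\rho$ be a permutation-symmetric state on $\mathcal H^{\otimes n}$, that is, a positive semidefinite operator with $\operatorname{Tr}\rho=1$ and $U_\pi\rho U_\pi^\dagger=\rho$ for all $\pi\in\mathcal S_n$. Then $$\rho\;\le\;\binom{n+d^2-1}{n}^{3}\int_{|\psi\rangle\in S_{\mathcal H\otimes\mathcal H'}}F\big(\rho,\sigma(\psi)^{\otimes n}\big)^2\,\sigma(\psi)^{\otimes n}\,\mathrm d\psi .$$ Here $A\le B$ means that $B-A$ is positive semidefinite, $\mathrm d\psi$ is the uniform (unitarily invariant) probability measure on the unit sphere $S_{\mathcal H\otimes\mathcal H'}$ of $\mathcal H\otimes\mathcal H'$, $\sigma(\psi)=\operatorname{Tr}_{\mathcal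 H'}|\psi\rangle\langle\psi|$ is the reduced state on $\mathcal H$, and $F(\rho,\sigma)=\|\sqrt\rho\sqrt\sigma\|_1$ is the fidelity, where $\|A\|_1=\operatorname{Tr}\sqrt{A^\dagger A}$. The integrand is integrable. -/

import Mathlib

open MeasureTheory
open scoped Matrix MatrixOrder ComplexOrder

/-! The Hilbert space `H = ℂ^d` is given by a finite index set `ι` with `d` elements, labelling the
fixed orthonormal basis `|i⟩`. Then `H ⊗ H'` has the basis `ι × ι'`, and `H^{⊗n}` has the basis
`|x 0⟩ ⊗ ⋯ ⊗ |x (n - 1)⟩` labelled by `x : Fin n → ι`. Operators are matrices in these bases. -/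

namespace DeFinetti

section Matrices

variable {ι ι' : Type*} [Fintype ι] [Fintype ι']

/-- A (mixed) quantum state: a positive semidefinite operator of trace one. -/
def IsState (ρ : Matrix ι ι ℂ) : Prop :=
  ρ.PosSemidef ∧ ρ.trace = 1

/-- The unitary `U_π` on `H^{⊗n}` with `U_π |y₁ ⋯ yₙ⟩ = |y_{π 1} ⋯ y_{π n}⟩`. -/
def permUnitary [DecidableEq ι] {n : ℕ} (π : Equiv.Perm (Fin n)) :
    Matrix (Fin n → ι) (Fin n → ι) ℂ :=
  Matrix.of fun x y => if x = y ∘ π then 1 else 0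

/-- Permutation-invariant operators on `H^{⊗n}`: `U_π ρ U_π† = ρ` for every `π ∈ 𝒮ₙ`. -/
def IsPermSymmetric [DecidableEq ι] {n : ℕ} (ρ : Matrix (Fin n → ι) (Fin n → ι) ℂ) : Prop :=
  ∀ π : Equiv.Perm (Fin n), permUnitary π * ρ * (permUnitary π)ᴴ = ρ

/-- The tensor power `A^{⊗n}` of an operator `A` on `H`, as an operator on `H^{⊗n}`. -/
def tensorPow (A : Matrix ι ι ℂ) (n : ℕ) : Matrix (Fin n → ι) (Fin n → ι) ℂ :=
  Matrix.of fun x y => ∏ k, A (x k) (y k)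

/-- The partial trace over the second factor of an operator on `H ⊗ H'`. -/
def partialTrace (M : Matrix (ι × ι') (ι × ι') ℂ) : Matrix ι ι ℂ :=
  Matrix.of fun i j => ∑ k, M (i, k) (j, k)

/-- The rank-one operator `|ψ⟩⟨ψ|`. -/
def ketBra (ψ : EuclideanSpace ℂ ι) : Matrix ι ι ℂ :=
  Matrix.of fun i j => ψ i * star (ψ j)

/-- The reduced operator `σ(ψ) = Tr_{H'} |ψ⟩⟨ψ|` on `H` of a vector `ψ ∈ H ⊗ H'`. -/
def reducedState (ψ : EuclideanSpace ℂ (ι × ι')) : Matrix ι ι ℂ :=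
  partialTrace (ketBra ψ)

/-- The trace norm `‖A‖₁ = Tr √(A† A)`. -/
noncomputable def traceNorm [DecidableEq ι] (A : Matrix ι ι ℂ) : ℝ :=
  (CFC.sqrt (Aᴴ * A)).trace.re

/-- The fidelity `F(ρ, σ) = ‖√ρ √σ‖₁`. -/
noncomputable def fidelity [DecidableEq ι] (ρ σ : Matrix ι ι ℂ) : ℝ :=
  traceNorm (CFC.sqrt ρ * CFC.sqrt σ)

end Matrices

/-- The uniform probability measure on the unit sphere of the Hilbert space with orthonormal basis
labelled by `κ`: the surface measure induced by Lebesgue measure, normalised to total mass one. -/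
noncomputable def uniformSphere (κ : Type*) [Fintype κ] :
    Measure (Metric.sphere (0 : EuclideanSpace ℂ κ) 1) :=
  ((volume : Measure (EuclideanSpace ℂ κ)).toSphere Set.univ)⁻¹ •
    (volume : Measure (EuclideanSpace ℂ κ)).toSphere

/-- A matrix-valued function is integrable when all its entries are. -/
def MatrixIntegrable {α m : Type*} [MeasurableSpace α] (f : α → Matrix m m ℂ)
    (μ : Measure α) : Prop :=
  ∀ i j, Integrable (fun a => f a i j) μ

/-- The integral of a matrix-valued function, taken entry by entry. -/
noncomputable def matrixIntegral {α m : Type*} [MeasurableSpace α] (f : α → Matrix m m ℂ)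
    (μ : Measure α) : Matrix m m ℂ :=
  Matrix.of fun i j => ∫ a, f a i j ∂μ

/-- The integrand `F(ρ, σ(ψ)^{⊗n})² σ(ψ)^{⊗n}`, as a function of the unit vector `ψ ∈ H ⊗ H'`. -/
noncomputable def weightedTensorPow {ι ι' : Type*} [Fintype ι] [DecidableEq ι] [Fintype ι'] {n : ℕ}
    (ρ : Matrix (Fin n → ι) (Fin n → ι) ℂ)
    (ψ : Metric.sphere (0 : EuclideanSpace ℂ (ι × ι')) 1) :
    Matrix (Fin n → ι) (Fin n → ι) ℂ :=
  (fidelity ρ (tensorPow (reducedState ψ.1) n) ^ 2) • tensorPow (reducedState ψ.1) n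

end DeFinetti

/-!
Write `u^{⊗n}` for the tensor power of a unit vector `u ∈ K = H ⊗ H'` and `N` for the dimension
`(n + d² - 1).choose n` of the symmetric subspace of `K^{⊗n}`. Let `v` be the purification of `ρ`
with coefficient matrix `√ρ` (`purification`). Since `ρ` is permutation-invariant, so is `√ρ`, and
`v` is a symmetric vector. The powers `u^{⊗n}` resolve the identity of the symmetric subspace, so
`v = N ∫ ⟨u^{⊗n}, v⟩ u^{⊗n} du` (`symmetric_eq_choose_mul_integral`). As `du` is a probability
measure, the Cauchy-Schwarz inequality turns this into
`|v⟩⟨v| ≤ N² ∫ |⟨u^{⊗n}, v⟩|² (|u⟩⟨u|)^{⊗n} du`.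
The partial trace over `H'^{⊗n}` gives `ρ ≤ N² ∫ |⟨u^{⊗n}, v⟩|² σ(u)^{⊗n} du`, and the overlap of
two purifications is at most the fidelity of the reduced operators
(`norm_tensorPowInner_purification_le`). This proves the bound with `N²`, hence with `N³`.

The resolution of the identity rests on the moments of the uniform measure on the sphere
(`integral_uniformSphere_monomial`). These are read off from Gaussian integrals over `ℂ^D`, which
factor over the coordinates on the one hand and split in polar coordinates on the other. The overlap
bound rests on `|Tr A| ≤ ‖A‖₁` (`norm_trace_le_traceNorm`).
-/

namespace DeFinetti

/-! ### The trace norm and the fidelity -/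

section TraceNorm

variable {ι : Type*} [Fintype ι] [DecidableEq ι]

theorem trace_sqrt_eq_sum_eigenvalues {A : Matrix ι ι ℂ} (hA : A.PosSemidef) :
    (CFC.sqrt A).trace.re = ∑ i, √(hA.isHermitian.eigenvalues i) := by
  have h1 : CFC.sqrt A = cfc Real.sqrt A := by
    rw [CFC.sqrt_eq_real_sqrt A hA.nonneg, cfcₙ_eq_cfc]
  have h2 := hA.isHermitian.cfc_eq Real.sqrt
  rw [h1, h2, Matrix.IsHermitian.cfc, Unitary.conjStarAlgAut_apply, Matrix.trace_mul_comm,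
    ← mul_assoc]
  simp [Matrix.trace_diagonal]

theorem traceNorm_conjTranspose (A : Matrix ι ι ℂ) : traceNorm Aᴴ = traceNorm A := by
  have h1 := Matrix.posSemidef_conjTranspose_mul_self A
  have h2 := Matrix.posSemidef_conjTranspose_mul_self Aᴴ
  rw [traceNorm, traceNorm, trace_sqrt_eq_sum_eigenvalues h1, trace_sqrt_eq_sum_eigenvalues h2,
    (Matrix.IsHermitian.eigenvalues_eq_eigenvalues_iff h2.isHermitian h1.isHermitian).2]
  rw [Matrix.conjTranspose_conjTranspose, Matrix.charpoly_mul_comm]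

/-- `‖A‖₁` depends only on `A A†`. -/
theorem traceNorm_eq_of_mul_conjTranspose_eq {A B : Matrix ι ι ℂ} (h : A * Aᴴ = B * Bᴴ) :
    traceNorm A = traceNorm B := by
  rw [← traceNorm_conjTranspose A, ← traceNorm_conjTranspose B, traceNorm, traceNorm]
  simp [h]

/-- In an orthonormal eigenbasis `u` of `A† A` one has `|⟨u i, A (u i)⟩| ≤ ‖A (u i)‖`, and
`‖A (u i)‖` is the `i`-th singular value of `A`. -/
theorem norm_trace_le_traceNorm (A : Matrix ι ι ℂ) : ‖A.trace‖ ≤ traceNorm A := by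
  have h1 := Matrix.posSemidef_conjTranspose_mul_self A
  rw [traceNorm, trace_sqrt_eq_sum_eigenvalues h1]
  set b := h1.isHermitian.eigenvectorBasis
  have ht : A.trace = ∑ i, inner ℂ (b i) (Matrix.toEuclideanLin A (b i)) := by
    rw [← LinearMap.trace_eq_sum_inner, Matrix.toEuclideanLin_eq_toLin_orthonormal,
      Matrix.trace_toLin_eq]
  rw [ht]
  refine (norm_sum_le _ _).trans (Finset.sum_le_sum fun i _ => ?_)
  refine (norm_inner_le_norm _ _).trans ?_
  rw [b.norm_eq_one, one_mul]
  apply Real.le_sqrt_of_sq_le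
  rw [h1.isHermitian.eigenvalues_eq, ← Matrix.mulVec_mulVec, Matrix.dotProduct_mulVec,
    ← Matrix.star_mulVec, EuclideanSpace.norm_sq_eq, dotProduct, map_sum]
  apply le_of_eq
  refine Finset.sum_congr rfl fun j _ => ?_
  simp only [Matrix.toLpLin_apply, Pi.star_apply, RCLike.star_def, RCLike.conj_mul]
  norm_cast

/-- The overlap bound behind Uhlmann's theorem: `A` is the coefficient matrix of a purification of
`σ = A A†`, and `√ρ` that of a purification of `ρ`. -/
theorem norm_trace_sqrt_mul_le_fidelity {ρ σ A : Matrix ι ι ℂ}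
    (hσ : σ = A * Aᴴ) : ‖(CFC.sqrt ρ * A).trace‖ ≤ fidelity ρ σ := by
  refine (norm_trace_le_traceNorm _).trans (le_of_eq ?_)
  apply traceNorm_eq_of_mul_conjTranspose_eq
  have h0 : (0 : Matrix ι ι ℂ) ≤ σ := hσ ▸ (Matrix.posSemidef_self_mul_conjTranspose A).nonneg
  have hS : (CFC.sqrt σ)ᴴ = CFC.sqrt σ :=
    (Matrix.nonneg_iff_posSemidef.1 (CFC.sqrt_nonneg σ)).isHermitian
  have hs : CFC.sqrt σ * CFC.sqrt σ = A * Aᴴ := by rw [CFC.sqrt_mul_sqrt_self σ h0, hσ]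
  calc CFC.sqrt ρ * A * (CFC.sqrt ρ * A)ᴴ = CFC.sqrt ρ * (A * Aᴴ) * (CFC.sqrt ρ)ᴴ := by
        simp [Matrix.mul_assoc]
    _ = _ := by rw [← hs]; simp [Matrix.mul_assoc, hS]

open scoped Matrix.Norms.L2Operator in
theorem continuousOn_sqrt :
    ContinuousOn (CFC.sqrt : Matrix ι ι ℂ → Matrix ι ι ℂ) {A | 0 ≤ A} :=
  CFC.continuousOn_sqrt

theorem continuous_traceNorm : Continuous (traceNorm : Matrix ι ι ℂ → ℝ) := by
  have h : Continuous fun A : Matrix ι ι ℂ => CFC.sqrt (Aᴴ * A) :=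
    continuousOn_sqrt.comp_continuous (by fun_prop)
      fun A => (Matrix.posSemidef_conjTranspose_mul_self A).nonneg
  exact Complex.continuous_re.comp h.matrix_trace

theorem continuous_fidelity_right {X : Type*} [TopologicalSpace X] (ρ : Matrix ι ι ℂ)
    {σ : X → Matrix ι ι ℂ} (hσ : Continuous σ) (h0 : ∀ x, 0 ≤ σ x) :
    Continuous fun x => fidelity ρ (σ x) :=
  continuous_traceNorm.comp
    (continuous_const.mul (continuousOn_sqrt.comp_continuous hσ h0))

end TraceNorm

/-! ### Moments of the uniform measure on the sphere -/

section Moments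

/-- Polar coordinates for a homogeneous function of degree `k` against the Gaussian weight. -/
theorem integral_mul_exp_neg_norm_sq_eq_toSphere {E : Type*} [NormedAddCommGroup E]
    [NormedSpace ℝ E] [MeasurableSpace E] [BorelSpace E] [FiniteDimensional ℝ E] [Nontrivial E]
    (μ : Measure E) [μ.IsAddHaarMeasure] (g : E → ℂ) (k : ℕ)
    (hg : ∀ (r : ℝ) (u : E), 0 < r → g (r • u) = (r : ℂ) ^ k * g u) :
    ∫ x, g x * (Real.exp (-‖x‖ ^ 2) : ℂ) ∂μ =
      (∫ u, g u.1 ∂μ.toSphere) *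
        ((1 / 2 * Real.Gamma ((Module.finrank ℝ E + k : ℝ) / 2) : ℝ) : ℂ) := by
  have hdim : 0 < Module.finrank ℝ E := Module.finrank_pos
  calc ∫ x, g x * (Real.exp (-‖x‖ ^ 2) : ℂ) ∂μ
      = ∫ x : ({(0)}ᶜ : Set E), g x.1 * (Real.exp (-‖x.1‖ ^ 2) : ℂ) ∂(μ.comap (↑)) := by
        rw [integral_subtype_comap (measurableSet_singleton _).compl
          fun x => g x * (Real.exp (-‖x‖ ^ 2) : ℂ), restrict_compl_singleton]
    _ = ∫ z : Metric.sphere (0 : E) 1 × Set.Ioi (0 : ℝ),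
          g z.1.1 * (((z.2.1 : ℂ) ^ k) * (Real.exp (-z.2.1 ^ 2) : ℂ))
          ∂μ.toSphere.prod (.volumeIoiPow (Module.finrank ℝ E - 1)) := by
        rw [← μ.measurePreserving_homeomorphUnitSphereProd.integral_comp
          (Homeomorph.measurableEmbedding _)]
        refine integral_congr_ae (Filter.Eventually.of_forall fun x => ?_)
        obtain ⟨z, rfl⟩ := (homeomorphUnitSphereProd E).symm.surjective x
        have hz : ‖z.1.1‖ = 1 := by simp
        have hr : (0 : ℝ) < z.2.1 := z.2.2
        simp only [homeomorphUnitSphereProd_symm_apply_coe, Homeomorph.apply_symm_apply]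
        rw [hg _ _ hr, norm_smul, hz, Real.norm_of_nonneg hr.le, mul_one]
        ring
    _ = (∫ u, g u.1 ∂μ.toSphere) *
          ∫ r : Set.Ioi (0 : ℝ), (((r.1 : ℂ) ^ k) * (Real.exp (-r.1 ^ 2) : ℂ))
            ∂.volumeIoiPow (Module.finrank ℝ E - 1) :=
        integral_prod_mul (fun u : Metric.sphere (0 : E) 1 => g u.1)
          fun r : Set.Ioi (0 : ℝ) => (((r.1 : ℂ) ^ k) * (Real.exp (-r.1 ^ 2) : ℂ))
    _ = _ := by
        congr 1
        have hq : (-1 : ℝ) < ((Module.finrank ℝ E - 1 + k : ℕ) : ℝ) :=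
          lt_of_lt_of_le (by norm_num) (Nat.cast_nonneg _)
        have h := integral_rpow_mul_exp_neg_rpow (p := 2) two_pos hq
        have hc : (((Module.finrank ℝ E - 1 + k : ℕ) : ℝ) + 1) =
            (Module.finrank ℝ E + k : ℝ) := by
          rw [← Nat.cast_add_one, ← Nat.cast_add]; congr 1; omega
        rw [hc] at h
        rw [← h, ← integral_complex_ofReal]
        simp only [Measure.volumeIoiPow, ENNReal.ofReal]
        rw [integral_withDensity_eq_integral_smul,
          integral_subtype_comap measurableSet_Ioi fun a =>
            Real.toNNReal (a ^ (Module.finrank ℝ E - 1)) •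
              (((a : ℂ) ^ k) * (Real.exp (-a ^ 2) : ℂ)),
          setIntegral_congr_fun measurableSet_Ioi fun x hx => ?_]
        · rw [NNReal.smul_def, Real.coe_toNNReal _ (pow_nonneg hx.out.le _), Real.rpow_natCast,
            Real.rpow_ofNat, Complex.real_smul]
          push_cast
          ring
        · exact (measurable_subtype_coe.pow_const _).real_toNNReal

/-- The Gaussian moments of a complex variable. Those with `a ≠ b` vanish because a rotation of the
plane multiplies them by `-1`. -/
theorem integral_conj_pow_mul_pow_mul_exp (a b : ℕ) :
    ∫ z : ℂ, star z ^ a * z ^ b * (Real.exp (-‖z‖ ^ 2) : ℂ) =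
      if a = b then (Real.pi : ℂ) * (a.factorial : ℂ) else 0 := by
  split_ifs with hab
  · subst hab
    have h := Complex.integral_rpow_mul_exp_neg_rpow (p := 2) (q := (2 * a : ℕ)) one_le_two
      (lt_of_lt_of_le (by norm_num) (Nat.cast_nonneg _))
    have h2 : (((2 * a : ℕ) : ℝ) + 2) / 2 = a + 1 := by push_cast; ring
    rw [h2, Real.Gamma_nat_eq_factorial] at h
    have h3 : (2 * Real.pi / 2 * (a.factorial : ℝ)) = Real.pi * a.factorial := by ring
    rw [h3] at h
    have h4 : (Real.pi : ℂ) * (a.factorial : ℂ) = ((Real.pi * a.factorial : ℝ) : ℂ) := by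
      push_cast; rfl
    rw [h4, ← h, ← integral_complex_ofReal]
    refine integral_congr_ae (Filter.Eventually.of_forall fun z => ?_)
    simp only [Real.rpow_natCast, Real.rpow_ofNat]
    rw [← mul_pow, RCLike.star_def, RCLike.conj_mul]
    push_cast
    rw [pow_mul]
    rfl
  · have hne : ((b : ℂ) - a) ≠ 0 := by
      rw [sub_ne_zero]; exact_mod_cast Ne.symm hab
    have hner : ((b : ℝ) - a) ≠ 0 := by
      rw [sub_ne_zero]; exact_mod_cast Ne.symm hab
    -- The angle is chosen so that `star c ^ a * c ^ b = exp (i π)`.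
    set c : Circle := Circle.exp (Real.pi / ((b : ℝ) - a)) with hc
    have hcc : star (c : ℂ) ^ a * (c : ℂ) ^ b = -1 := by
      rw [RCLike.star_def, ← Circle.coe_inv_eq_conj, hc, ← Circle.exp_neg, Circle.coe_exp,
        Circle.coe_exp, ← Complex.exp_nat_mul, ← Complex.exp_nat_mul, ← Complex.exp_add,
        ← Complex.exp_pi_mul_I]
      congr 1
      push_cast
      field_simp
      ring
    have h := (rotation c).measurePreserving.integral_comp
      (rotation c).toHomeomorph.measurableEmbedding
      (fun z : ℂ => star z ^ a * z ^ b * (Real.exp (-‖z‖ ^ 2) : ℂ))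
    have h' : ∫ z : ℂ, star (rotation c z) ^ a * (rotation c z) ^ b *
        (Real.exp (-‖rotation c z‖ ^ 2) : ℂ) =
        - ∫ z : ℂ, star z ^ a * z ^ b * (Real.exp (-‖z‖ ^ 2) : ℂ) := by
      rw [← integral_neg]
      refine integral_congr_ae (Filter.Eventually.of_forall fun z => ?_)
      have hn : ‖(c : ℂ) * z‖ = ‖z‖ := by rw [norm_mul, Circle.norm_coe, one_mul]
      simp only [rotation_apply, hn, star_mul', mul_pow]
      linear_combination (star z ^ a * z ^ b * (Real.exp (-‖z‖ ^ 2) : ℂ)) * hcc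
    have h3 := h.symm.trans h'
    exact self_eq_neg.1 h3

/-- Both sides count the permutations carrying one word to the other: they form a coset of the
stabilizer of `x`, which permutes the positions of each letter. -/
theorem prod_ite_factorial_eq_card {κ : Type*} [Fintype κ] [DecidableEq κ] {n : ℕ}
    (x y : Fin n → κ) :
    (∏ j, if Fintype.card {k // x k = j} = Fintype.card {k // y k = j} then
      (Fintype.card {k // x k = j}).factorial else 0) =
      Fintype.card {π : Equiv.Perm (Fin n) // y ∘ π = x} := by
  by_cases h : ∀ j, Fintype.card {k // x k = j} = Fintype.card {k // y k = j}
  · let τ : Equiv.Perm (Fin n) := Equiv.ofFiberEquiv (f := x) (g := y)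
      fun j => Fintype.equivOfCardEq (h j)
    have hτ : y ∘ τ = x := funext fun k => Equiv.ofFiberEquiv_map _ k
    rw [Finset.prod_congr rfl fun j _ => if_pos (h j), ← DomMulAct.stabilizer_card x]
    refine Fintype.card_congr ((Equiv.mulLeft τ).subtypeEquiv fun π => ?_)
    rw [Equiv.coe_mulLeft, Equiv.Perm.coe_mul, ← Function.comp_assoc, hτ]
  · have : IsEmpty {π : Equiv.Perm (Fin n) // y ∘ π = x} := by
      refine ⟨fun ⟨π, hπ⟩ => h fun j => Fintype.card_congr (π.subtypeEquiv fun k => ?_)⟩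
      rw [← hπ]; rfl
    push Not at h
    obtain ⟨j, hj⟩ := h
    rw [Fintype.card_eq_zero, Finset.prod_eq_zero (Finset.mem_univ j) (if_neg hj)]

theorem prod_comp_eq_prod_pow_card {κ : Type*} [Fintype κ] [DecidableEq κ] {n : ℕ}
    (x : Fin n → κ) (f : κ → ℂ) : ∏ k, f (x k) = ∏ j, f j ^ Fintype.card {k // x k = j} := by
  rw [← Finset.prod_fiberwise' Finset.univ x f]
  refine Finset.prod_congr rfl fun j _ => ?_
  rw [Finset.prod_const, Fintype.card_subtype]

variable (κ : Type*) [Fintype κ]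

/-- Lebesgue measure on `EuclideanSpace ℂ κ` is a multiple of the product of the Lebesgue measures
on the coordinates; the value of the factor is irrelevant for normalised integrals. -/
theorem exists_integral_euclideanSpace_eq :
    ∃ C : ℝ, ∀ f : EuclideanSpace ℂ κ → ℂ,
      ∫ x, f x = C * ∫ x : κ → ℂ, f (WithLp.toLp 2 x) := by
  let L : (κ → ℂ) ≃L[ℝ] EuclideanSpace ℂ κ := (PiLp.continuousLinearEquiv 2 ℝ fun _ : κ => ℂ).symm
  let μ : Measure (EuclideanSpace ℂ κ) := Measure.map L (volume : Measure (κ → ℂ))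
  have : μ.IsAddHaarMeasure := L.isAddHaarMeasure_map _
  have h := Measure.isAddLeftInvariant_eq_smul (volume : Measure (EuclideanSpace ℂ κ)) μ
  refine ⟨(Measure.addHaarScalarFactor (volume : Measure (EuclideanSpace ℂ κ)) μ : ℝ),
    fun f => ?_⟩
  conv_lhs => rw [h]
  rw [integral_smul_nnreal_measure, NNReal.smul_def, Complex.real_smul]
  congr 1
  exact L.toHomeomorph.measurableEmbedding.integral_map f

theorem finrank_real_euclideanSpace_complex :
    Module.finrank ℝ (EuclideanSpace ℂ κ) = 2 * Fintype.card κ := by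
  rw [← Module.finrank_mul_finrank ℝ ℂ, Complex.finrank_real_complex, finrank_euclideanSpace]

variable {κ}

theorem integral_gaussian_monomial [DecidableEq κ] {n : ℕ} (x y : Fin n → κ) :
    ∫ u : κ → ℂ, (∏ k, star (u (x k)) * u (y k)) *
        (Real.exp (-‖(WithLp.toLp 2 u : EuclideanSpace ℂ κ)‖ ^ 2) : ℂ) =
      (Real.pi : ℂ) ^ Fintype.card κ *
        (Fintype.card {π : Equiv.Perm (Fin n) // y ∘ π = x} : ℂ) := by
  have h : ∀ u : κ → ℂ, (∏ k, star (u (x k)) * u (y k)) *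
        (Real.exp (-‖(WithLp.toLp 2 u : EuclideanSpace ℂ κ)‖ ^ 2) : ℂ) =
      ∏ j, (star (u j) ^ Fintype.card {k // x k = j} * u j ^ Fintype.card {k // y k = j} *
        (Real.exp (-‖u j‖ ^ 2) : ℂ)) := by
    intro u
    rw [Finset.prod_mul_distrib, Finset.prod_mul_distrib, Finset.prod_mul_distrib,
      prod_comp_eq_prod_pow_card x fun j => star (u j), prod_comp_eq_prod_pow_card y u,
      EuclideanSpace.norm_sq_eq, ← Finset.sum_neg_distrib, Real.exp_sum]
    push_cast
    rfl
  simp_rw [h]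
  rw [integral_fintype_prod_volume_eq_prod fun (j : κ) (z : ℂ) =>
    star z ^ Fintype.card {k // x k = j} * z ^ Fintype.card {k // y k = j} *
        (Real.exp (-‖z‖ ^ 2) : ℂ)]
  simp_rw [integral_conj_pow_mul_pow_mul_exp]
  rw [← prod_ite_factorial_eq_card, Nat.cast_prod, ← Finset.card_univ, ← Finset.prod_const,
    ← Finset.prod_mul_distrib]
  refine Finset.prod_congr rfl fun j _ => ?_
  split_ifs <;> simp

instance isProbabilityMeasure_uniformSphere [Nonempty κ] :
    IsProbabilityMeasure (uniformSphere κ) := by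
  constructor
  rw [uniformSphere, Measure.smul_apply, smul_eq_mul]
  exact ENNReal.inv_mul_cancel
    (by rw [Ne, Measure.measure_univ_eq_zero]; exact Measure.toSphere_ne_zero _)
    (measure_ne_top _ _)

theorem integral_uniformSphere (f : Metric.sphere (0 : EuclideanSpace ℂ κ) 1 → ℂ) :
    ∫ u, f u ∂uniformSphere κ =
      (∫ u, f u ∂(volume : Measure (EuclideanSpace ℂ κ)).toSphere) /
        ∫ _u, 1 ∂(volume : Measure (EuclideanSpace ℂ κ)).toSphere := by
  rw [uniformSphere, integral_smul_measure, integral_const, Complex.real_smul, Complex.real_smul,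
    ENNReal.toReal_inv, div_eq_inv_mul]
  simp [Measure.real]

/-- The moments of the uniform measure on the sphere. They are the ratio of the Gaussian moments of
degree `2 n` and of degree `0`. -/
theorem integral_uniformSphere_monomial [DecidableEq κ] [Nonempty κ] {n : ℕ} (x y : Fin n → κ) :
    ∫ u, ∏ k, star (u.1 (x k)) * u.1 (y k) ∂uniformSphere κ =
      (Fintype.card {π : Equiv.Perm (Fin n) // y ∘ π = x} : ℂ) *
        ((Fintype.card κ - 1).factorial / (n + (Fintype.card κ - 1)).factorial) := by
  obtain ⟨D, hD⟩ : ∃ D, Fintype.card κ = D + 1 :=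
    ⟨_, (Nat.succ_pred_eq_of_pos Fintype.card_pos).symm⟩
  obtain ⟨C, hC⟩ := exists_integral_euclideanSpace_eq κ
  -- The Gaussian integral of a monomial, in polar and in Cartesian coordinates.
  have key : ∀ {m : ℕ} (x y : Fin m → κ),
      (∫ u, ∏ k, star (u.1 (x k)) * u.1 (y k)
        ∂(volume : Measure (EuclideanSpace ℂ κ)).toSphere) *
        (((m + D).factorial : ℂ) / 2) =
      C * ((Real.pi : ℂ) ^ Fintype.card κ *
        (Fintype.card {π : Equiv.Perm (Fin m) // y ∘ π = x} : ℂ)) := by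
    intro m x y
    have h := integral_mul_exp_neg_norm_sq_eq_toSphere
      (volume : Measure (EuclideanSpace ℂ κ))
      (fun u => ∏ k, star (u (x k)) * u (y k)) (2 * m) (fun r u _ => by
        simp only [PiLp.smul_apply, Complex.real_smul, star_mul']
        simp only [RCLike.star_def, Complex.conj_ofReal]
        rw [pow_mul, Finset.prod_congr rfl fun k _ =>
          show (r : ℂ) * (starRingEnd ℂ) (u (x k)) * (r * u (y k)) =
            (r : ℂ) ^ 2 * ((starRingEnd ℂ) (u (x k)) * u (y k)) by ring,
          Finset.prod_mul_distrib]
        simp)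
    rw [hC, integral_gaussian_monomial x y, finrank_real_euclideanSpace_complex] at h
    rw [h]
    congr 1
    have h2 : (((2 * Fintype.card κ : ℕ) : ℝ) + ((2 * m : ℕ) : ℝ)) / 2 = ((m + D : ℕ) : ℝ) + 1 := by
      rw [hD]; push_cast; ring
    rw [h2, Real.Gamma_nat_eq_factorial]
    push_cast
    ring
  -- Degree `0` expresses the unknown factor `C * π ^ D` through the area of the sphere.
  have h0 := key (m := 0) (fun k => k.elim0) (fun k => k.elim0)
  have hcard : Fintype.card {π : Equiv.Perm (Fin 0) //
      (fun k => k.elim0 : Fin 0 → κ) ∘ π = fun k => k.elim0} = 1 := by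
    rw [Fintype.card_eq_one_iff]
    exact ⟨⟨1, Subsingleton.elim _ _⟩, fun _ => Subsingleton.elim _ _⟩
  simp only [Finset.univ_eq_empty, Finset.prod_empty, hcard, Nat.cast_one, mul_one,
    zero_add] at h0
  have h1 := key x y
  have hS : (∫ _u, (1 : ℂ) ∂(volume : Measure (EuclideanSpace ℂ κ)).toSphere) ≠ 0 := by
    rw [integral_const, Complex.real_smul, mul_one, Complex.ofReal_ne_zero, Measure.real,
      ENNReal.toReal_ne_zero]
    exact ⟨by rw [Ne, Measure.measure_univ_eq_zero]; exact Measure.toSphere_ne_zero _,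
      measure_ne_top _ _⟩
  rw [integral_uniformSphere, hD, Nat.add_sub_cancel]
  have hf1 : ((n + D).factorial : ℂ) ≠ 0 := by exact_mod_cast Nat.factorial_ne_zero _
  rw [div_eq_iff hS, mul_assoc, div_mul_eq_mul_div, mul_div_assoc', eq_div_iff hf1]
  rw [← mul_assoc, ← h0] at h1
  linear_combination 2 * h1

end Moments

/-! ### Resolution of the identity on the symmetric subspace -/

section CoherentVectors

variable {κ : Type*} [Fintype κ]

theorem integrable_uniformSphere [Nonempty κ] {E : Type*} [NormedAddCommGroup E]
    {f : Metric.sphere (0 : EuclideanSpace ℂ κ) 1 → E} (hf : Continuous f) :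
    Integrable f (uniformSphere κ) :=
  hf.integrable_of_hasCompactSupport (HasCompactSupport.of_compactSpace f)

/-- The inner product `⟨u^{⊗n}, v⟩` for a vector `v` given by its coordinates. -/
noncomputable def tensorPowInner {n : ℕ} (v : (Fin n → κ) → ℂ) (u : EuclideanSpace ℂ κ) : ℂ :=
  ∑ x, (∏ k, star (u (x k))) * v x

/-- The vectors `u^{⊗n}` resolve the identity of the symmetric subspace, whose dimension is
`(n + D - 1).choose n`. -/
theorem symmetric_eq_choose_mul_integral [Nonempty κ] {n : ℕ} (v : (Fin n → κ) → ℂ)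
    (hv : ∀ (π : Equiv.Perm (Fin n)) x, v (x ∘ π) = v x) (y : Fin n → κ) :
    v y = ((n + Fintype.card κ - 1).choose n : ℂ) *
      ∫ u, tensorPowInner v u.1 * ∏ k, u.1 (y k) ∂uniformSphere κ := by
  classical
  obtain ⟨D, hD⟩ : ∃ D, Fintype.card κ = D + 1 :=
    ⟨_, (Nat.succ_pred_eq_of_pos Fintype.card_pos).symm⟩
  have h1 : ∀ u : Metric.sphere (0 : EuclideanSpace ℂ κ) 1,
      tensorPowInner v u.1 * ∏ k, u.1 (y k) =
        ∑ x, v x * ∏ k, star (u.1 (x k)) * u.1 (y k) := by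
    intro u
    rw [tensorPowInner, Finset.sum_mul]
    refine Finset.sum_congr rfl fun x _ => ?_
    rw [Finset.prod_mul_distrib]
    ring
  -- Symmetry of `v` makes every permutation contribute `v y`.
  have h2 : ∑ x, v x * (Fintype.card {π : Equiv.Perm (Fin n) // y ∘ π = x} : ℂ) =
      n.factorial * v y := by
    calc ∑ x, v x * (Fintype.card {π : Equiv.Perm (Fin n) // y ∘ π = x} : ℂ)
        = ∑ x, ∑ π : Equiv.Perm (Fin n), if y ∘ π = x then v x else 0 := by
          refine Finset.sum_congr rfl fun x _ => ?_
          rw [Fintype.card_subtype, Finset.card_filter, Nat.cast_sum, Finset.mul_sum]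
          refine Finset.sum_congr rfl fun π _ => ?_
          split_ifs <;> simp
      _ = ∑ π : Equiv.Perm (Fin n), v (y ∘ π) := by
          rw [Finset.sum_comm]
          simp
      _ = _ := by simp [hv, Fintype.card_perm]
  simp_rw [h1]
  rw [integral_finsetSum _ fun x _ => integrable_uniformSphere (by fun_prop)]
  simp_rw [integral_const_mul, integral_uniformSphere_monomial, ← mul_assoc]
  rw [← Finset.sum_mul, h2, hD, Nat.add_sub_cancel, ← add_assoc, Nat.add_sub_cancel]
  have h3 : ((n + D).choose n : ℂ) * n.factorial * D.factorial = (n + D).factorial := by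
    have := Nat.choose_mul_factorial_mul_factorial (Nat.le_add_right n D)
    rw [Nat.add_sub_cancel_left] at this
    exact_mod_cast this
  have h4 : ((n + D).factorial : ℂ) ≠ 0 := by exact_mod_cast Nat.factorial_ne_zero _
  field_simp
  linear_combination -v y * h3

end CoherentVectors

/-! ### Integrals of scalars and of matrices -/

theorem norm_integral_sq_le {α : Type*} [MeasurableSpace α] {μ : Measure α}
    [IsProbabilityMeasure μ] {f : α → ℂ} (hf : Integrable f μ)
    (hf2 : Integrable (fun a => ‖f a‖ ^ 2) μ) : ‖∫ a, f a ∂μ‖ ^ 2 ≤ ∫ a, ‖f a‖ ^ 2 ∂μ :=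
  (pow_le_pow_left₀ (norm_nonneg _) (norm_integral_le_integral_norm f) 2).trans
    ((even_two.convexOn_pow (𝕜 := ℝ)).map_integral_le (continuous_pow 2).continuousOn isClosed_univ
      (Filter.Eventually.of_forall fun _ => Set.mem_univ _) hf.norm hf2)

theorem star_dotProduct_mul_conjTranspose_mulVec {m : Type*} [Fintype m]
    (A : Matrix m m ℂ) (w : m → ℂ) :
    star w ⬝ᵥ (A * Aᴴ) *ᵥ w = ((∑ y, ‖(star w ᵥ* A) y‖ ^ 2 : ℝ) : ℂ) := by
  have h : Aᴴ *ᵥ w = star (star w ᵥ* A) := by rw [Matrix.star_vecMul, star_star]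
  rw [← Matrix.mulVec_mulVec, Matrix.dotProduct_mulVec, h, dotProduct, Complex.ofReal_sum]
  refine Finset.sum_congr rfl fun y _ => ?_
  rw [Pi.star_apply, RCLike.star_def, Complex.mul_conj']
  push_cast
  rfl

theorem star_dotProduct_matrixIntegral_mulVec {α m : Type*} [MeasurableSpace α] [Fintype m]
    {μ : Measure α} {f : α → Matrix m m ℂ} (hf : MatrixIntegrable f μ) (w : m → ℂ) :
    star w ⬝ᵥ matrixIntegral f μ *ᵥ w = ∫ a, star w ⬝ᵥ f a *ᵥ w ∂μ := by
  have hi : ∀ x y, Integrable (fun a => f a x y * w y) μ := fun x y => (hf x y).mul_const _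
  simp only [dotProduct, Matrix.mulVec, matrixIntegral, Matrix.of_apply]
  rw [integral_finsetSum _ fun x _ => (integrable_finsetSum _ fun y _ => hi x y).const_mul _]
  refine Finset.sum_congr rfl fun x _ => ?_
  rw [integral_const_mul, integral_finsetSum _ fun y _ => hi x y]
  simp_rw [integral_mul_const]

theorem isHermitian_matrixIntegral {α m : Type*} [MeasurableSpace α]
    {μ : Measure α} {f : α → Matrix m m ℂ} (hf : ∀ a, (f a).IsHermitian) :
    (matrixIntegral f μ).IsHermitian := by
  ext x y
  simp only [matrixIntegral, Matrix.conjTranspose_apply, Matrix.of_apply, RCLike.star_def]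
  rw [← integral_conj]
  exact integral_congr_ae (Filter.Eventually.of_forall fun a => (hf a).apply x y)

/-! ### The symmetric purification -/

theorem continuous_tensorPow_reducedState {ι ι' : Type*} [Fintype ι'] (n : ℕ) :
    Continuous fun u : EuclideanSpace ℂ (ι × ι') => tensorPow (reducedState u) n := by
  refine continuous_matrix fun x y => ?_
  simp only [tensorPow, reducedState, partialTrace, ketBra, Matrix.of_apply]
  fun_prop

section Purification

variable {ι ι' : Type*} [Fintype ι] [Fintype ι']

/-- The coefficient matrix of `u^{⊗n}` with respect to the splitting `H^{⊗n} ⊗ H'^{⊗n}`, the basis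
of `H'` being labelled by `ι` through `e`. -/
def coeffMatrix (e : ι ≃ ι') (n : ℕ) (u : EuclideanSpace ℂ (ι × ι')) :
    Matrix (Fin n → ι) (Fin n → ι) ℂ :=
  Matrix.of fun x y => ∏ k, u (x k, e (y k))

theorem coeffMatrix_mul_conjTranspose [DecidableEq ι] (e : ι ≃ ι') (n : ℕ)
    (u : EuclideanSpace ℂ (ι × ι')) :
    coeffMatrix e n u * (coeffMatrix e n u)ᴴ = tensorPow (reducedState u) n := by
  ext x y
  simp only [Matrix.mul_apply, Matrix.conjTranspose_apply, coeffMatrix, tensorPow, reducedState,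
    partialTrace, ketBra, Matrix.of_apply]
  rw [Finset.prod_congr rfl fun k _ =>
      (Equiv.sum_comp e fun j => u (x k, j) * star (u (y k, j))).symm,
    Finset.prod_univ_sum, Fintype.piFinset_univ]
  refine Finset.sum_congr rfl fun z _ => ?_
  rw [star_prod, Finset.prod_mul_distrib]

theorem IsPermSymmetric.apply_comp [DecidableEq ι] {n : ℕ}
    {ρ : Matrix (Fin n → ι) (Fin n → ι) ℂ} (h : IsPermSymmetric ρ) (π : Equiv.Perm (Fin n))
    (x y : Fin n → ι) : ρ (x ∘ π) (y ∘ π) = ρ x y := by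
  have hπ : ∀ a b : Fin n → ι, a ∘ π = b ∘ π ↔ b = a := fun a b =>
    ⟨fun hab => (π.surjective.injective_comp_right hab).symm, fun hab => hab ▸ rfl⟩
  have h1 := congrFun (congrFun (h π) (x ∘ π)) (y ∘ π)
  rw [← h1]
  simp [Matrix.mul_apply, permUnitary, hπ]

theorem IsPermSymmetric.sqrt_apply_comp [DecidableEq ι] {n : ℕ}
    {ρ : Matrix (Fin n → ι) (Fin n → ι) ℂ} (h : IsPermSymmetric ρ) (h0 : ρ.PosSemidef)
    (π : Equiv.Perm (Fin n)) (x y : Fin n → ι) :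
    CFC.sqrt ρ (x ∘ π) (y ∘ π) = CFC.sqrt ρ x y := by
  -- Relabelling the basis by `π` maps `√ρ` to a positive square root of `ρ`, hence to `√ρ`.
  let s : (Fin n → ι) ≃ (Fin n → ι) := Equiv.arrowCongr π.symm (Equiv.refl ι)
  have hs : ∀ x, s x = x ∘ π := fun x => rfl
  have hR : (CFC.sqrt ρ).PosSemidef := Matrix.nonneg_iff_posSemidef.1 (CFC.sqrt_nonneg ρ)
  have h1 : CFC.sqrt ρ = (CFC.sqrt ρ).submatrix s s := by
    refine CFC.sqrt_unique ?_ (hR.submatrix s).nonneg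
    rw [Matrix.submatrix_mul_equiv, CFC.sqrt_mul_sqrt_self ρ h0.nonneg]
    ext a b
    exact h.apply_comp π a b
  conv_rhs => rw [h1]
  rfl

/-- The coordinates of the purification of `ρ` with coefficient matrix `√ρ`. It is a symmetric
vector of `(H ⊗ H')^{⊗n}` when `ρ` is permutation-invariant. -/
noncomputable def purification [DecidableEq ι] (e : ι ≃ ι') {n : ℕ}
    (ρ : Matrix (Fin n → ι) (Fin n → ι) ℂ) (z : Fin n → ι × ι') : ℂ :=
  CFC.sqrt ρ (fun k => (z k).1) (fun k => e.symm (z k).2)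

theorem tensorPowInner_purification [DecidableEq ι] (e : ι ≃ ι') {n : ℕ}
    (ρ : Matrix (Fin n → ι) (Fin n → ι) ℂ) (u : EuclideanSpace ℂ (ι × ι')) :
    tensorPowInner (purification e ρ) u = (CFC.sqrt ρ * (coeffMatrix e n u)ᴴ).trace := by
  let E : (Fin n → ι × ι') ≃ (Fin n → ι) × (Fin n → ι) :=
    (Equiv.arrowProdEquivProdArrow (Fin n) (fun _ => ι) (fun _ => ι')).trans
      ((Equiv.refl _).prodCongr ((Equiv.refl _).arrowCongr e.symm))
  simp only [Matrix.trace, Matrix.diag_apply, Matrix.mul_apply]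
  rw [← Fintype.sum_prod_type', tensorPowInner]
  refine Fintype.sum_equiv E _ _ fun z => ?_
  have h2 : (E z).2 = fun k => e.symm (z k).2 := rfl
  have h1 : (E z).1 = fun k => (z k).1 := rfl
  rw [h1, h2, mul_comm, purification, Matrix.conjTranspose_apply, coeffMatrix, Matrix.of_apply,
    star_prod]
  simp

theorem norm_tensorPowInner_purification_le [DecidableEq ι] (e : ι ≃ ι') {n : ℕ}
    (ρ : Matrix (Fin n → ι) (Fin n → ι) ℂ) (u : EuclideanSpace ℂ (ι × ι')) :
    ‖tensorPowInner (purification e ρ) u‖ ≤ fidelity ρ (tensorPow (reducedState u) n) := by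
  have hR : (CFC.sqrt ρ)ᴴ = CFC.sqrt ρ :=
    (Matrix.nonneg_iff_posSemidef.1 (CFC.sqrt_nonneg ρ)).isHermitian
  rw [tensorPowInner_purification, ← norm_star, ← Matrix.trace_conjTranspose,
    Matrix.conjTranspose_mul, Matrix.conjTranspose_conjTranspose, hR, Matrix.trace_mul_comm]
  exact norm_trace_sqrt_mul_le_fidelity (coeffMatrix_mul_conjTranspose e n u).symm

theorem posSemidef_tensorPow_reducedState [DecidableEq ι] (e : ι ≃ ι') (n : ℕ)
    (u : EuclideanSpace ℂ (ι × ι')) : (tensorPow (reducedState u) n).PosSemidef :=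
  coeffMatrix_mul_conjTranspose e n u ▸ Matrix.posSemidef_self_mul_conjTranspose _

theorem continuous_fidelity_tensorPow_reducedState [DecidableEq ι] (e : ι ≃ ι') {n : ℕ}
    (ρ : Matrix (Fin n → ι) (Fin n → ι) ℂ) :
    Continuous fun u : EuclideanSpace ℂ (ι × ι') => fidelity ρ (tensorPow (reducedState u) n) :=
  continuous_fidelity_right ρ (continuous_tensorPow_reducedState n)
    fun u => (posSemidef_tensorPow_reducedState e n u).nonneg

/-- The integral formula for the symmetric purification, contracted with `w` on the system `H^{⊗n}`
and with a basis vector on `H'^{⊗n}`. -/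
theorem vecMul_sqrt_eq_integral [DecidableEq ι] [Nonempty (ι × ι')] (e : ι ≃ ι') {n : ℕ}
    {ρ : Matrix (Fin n → ι) (Fin n → ι) ℂ} (h0 : ρ.PosSemidef) (h : IsPermSymmetric ρ)
    (w : (Fin n → ι) → ℂ) (y : Fin n → ι) :
    (w ᵥ* CFC.sqrt ρ) y = ((n + Fintype.card (ι × ι') - 1).choose n : ℂ) *
      ∫ u, tensorPowInner (purification e ρ) u.1 * (w ᵥ* coeffMatrix e n u.1) y
        ∂uniformSphere (ι × ι') := by
  have hc : Continuous fun u : Metric.sphere (0 : EuclideanSpace ℂ (ι × ι')) 1 =>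
      tensorPowInner (purification e ρ) u.1 := by
    unfold tensorPowInner
    fun_prop
  have h1 : ∀ x, CFC.sqrt ρ x y = ((n + Fintype.card (ι × ι') - 1).choose n : ℂ) *
      ∫ u, tensorPowInner (purification e ρ) u.1 * coeffMatrix e n u.1 x y
        ∂uniformSphere (ι × ι') := by
    intro x
    have := symmetric_eq_choose_mul_integral (purification e ρ)
      (fun π z => h.sqrt_apply_comp h0 π (fun k => (z k).1) fun k => e.symm (z k).2) fun k => (x k, e (y k))
    simpa only [purification, coeffMatrix, Matrix.of_apply, Equiv.symm_apply_apply] using this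
  simp only [Matrix.vecMul, dotProduct, Finset.mul_sum]
  rw [integral_finsetSum, Finset.mul_sum]
  · refine Finset.sum_congr rfl fun x _ => ?_
    rw [h1 x]
    simp_rw [mul_left_comm _ (w x)]
    rw [integral_const_mul]
    ring
  · intro x _
    refine integrable_uniformSphere (hc.mul (continuous_const.mul ?_))
    simp only [coeffMatrix, Matrix.of_apply]
    fun_prop

end Purification

end DeFinetti

open DeFinetti in
theorem mainTheorem1 {ι ι' : Type*} [Fintype ι] [DecidableEq ι] [Fintype ι'] (d n : ℕ)
    (hd : 1 ≤ d) (hι : Fintype.card ι = d) (hι' : Fintype.card ι' = d)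
    (ρ : Matrix (Fin n → ι) (Fin n → ι) ℂ) (hρ : DeFinetti.IsState ρ)
    (hsymm : DeFinetti.IsPermSymmetric ρ) :
    DeFinetti.MatrixIntegrable
      (fun ψ : Metric.sphere (0 : EuclideanSpace ℂ (ι × ι')) 1 => DeFinetti.weightedTensorPow ρ ψ)
      (DeFinetti.uniformSphere (ι × ι')) ∧
    ρ ≤ ((n + d ^ 2 - 1).choose n : ℝ) ^ 3 •
      DeFinetti.matrixIntegral
        (fun ψ : Metric.sphere (0 : EuclideanSpace ℂ (ι × ι')) 1 => DeFinetti.weightedTensorPow ρ ψ)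
        (DeFinetti.uniformSphere (ι × ι')) := by
  have e : ι ≃ ι' := Fintype.equivOfCardEq (hι.trans hι'.symm)
  have hcard : Fintype.card (ι × ι') = d ^ 2 := by rw [Fintype.card_prod, hι, hι', sq]
  have : Nonempty (ι × ι') := Fintype.card_pos_iff.1 (hcard ▸ Nat.pow_pos hd)
  have hF := (continuous_fidelity_tensorPow_reducedState e ρ).comp
    (continuous_subtype_val (p := fun u => u ∈ Metric.sphere (0 : EuclideanSpace ℂ (ι × ι')) 1))
  have hT := (continuous_tensorPow_reducedState (ι := ι) (ι' := ι') n).comp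
    (continuous_subtype_val (p := fun u => u ∈ Metric.sphere (0 : EuclideanSpace ℂ (ι × ι')) 1))
  have hint : MatrixIntegrable
      (fun ψ : Metric.sphere (0 : EuclideanSpace ℂ (ι × ι')) 1 => weightedTensorPow ρ ψ)
      (uniformSphere (ι × ι')) := fun x y =>
    integrable_uniformSphere (((hF.pow 2).smul hT).matrix_elem x y)
  refine ⟨hint, ?_⟩
  set N : ℕ := (n + d ^ 2 - 1).choose n with hN
  have hN1 : (1 : ℝ) ≤ N := by
    have : 1 ≤ d ^ 2 := Nat.one_le_pow _ _ hd
    exact_mod_cast Nat.choose_pos (by omega)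
  have hM : (matrixIntegral (fun ψ : Metric.sphere (0 : EuclideanSpace ℂ (ι × ι')) 1 =>
      weightedTensorPow ρ ψ) (uniformSphere (ι × ι'))).IsHermitian :=
    isHermitian_matrixIntegral fun ψ =>
      (posSemidef_tensorPow_reducedState e n ψ.1).isHermitian.smul
        (IsSelfAdjoint.all (fidelity ρ (tensorPow (reducedState ψ.1) n) ^ 2))
  rw [Matrix.le_iff]
  refine Matrix.PosSemidef.of_dotProduct_mulVec_nonneg
    ((hM.smul (IsSelfAdjoint.all ((N : ℝ) ^ 3))).sub hρ.1.isHermitian) fun w => ?_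
  have hρR : CFC.sqrt ρ * (CFC.sqrt ρ)ᴴ = ρ := by
    rw [(Matrix.nonneg_iff_posSemidef.1 (CFC.sqrt_nonneg ρ)).isHermitian,
      CFC.sqrt_mul_sqrt_self ρ hρ.1.nonneg]
  have hq : ∀ ψ : Metric.sphere (0 : EuclideanSpace ℂ (ι × ι')) 1,
      star w ⬝ᵥ weightedTensorPow ρ ψ *ᵥ w =
        ((fidelity ρ (tensorPow (reducedState ψ.1) n) ^ 2 *
          ∑ y, ‖(star w ᵥ* coeffMatrix e n ψ.1) y‖ ^ 2 : ℝ) : ℂ) := by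
    intro ψ
    rw [Complex.ofReal_mul, ← star_dotProduct_mul_conjTranspose_mulVec,
      coeffMatrix_mul_conjTranspose, weightedTensorPow, Matrix.smul_mulVec, dotProduct_smul,
      Complex.real_smul]
  have hA : ∀ y, Continuous fun ψ : Metric.sphere (0 : EuclideanSpace ℂ (ι × ι')) 1 =>
      (star w ᵥ* coeffMatrix e n ψ.1) y := by
    intro y
    simp only [Matrix.vecMul, dotProduct, coeffMatrix, Matrix.of_apply]
    fun_prop
  have hc : Continuous fun ψ : Metric.sphere (0 : EuclideanSpace ℂ (ι × ι')) 1 =>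
      tensorPowInner (purification e ρ) ψ.1 := by
    unfold tensorPowInner
    fun_prop
  have hG : ∀ y, Continuous fun ψ : Metric.sphere (0 : EuclideanSpace ℂ (ι × ι')) 1 =>
      ‖tensorPowInner (purification e ρ) ψ.1 * (star w ᵥ* coeffMatrix e n ψ.1) y‖ ^ 2 :=
    fun y => (hc.mul (hA y)).norm.pow 2
  rw [Matrix.sub_mulVec, dotProduct_sub, Matrix.smul_mulVec, dotProduct_smul,
    star_dotProduct_matrixIntegral_mulVec hint]
  have hqρ := star_dotProduct_mul_conjTranspose_mulVec (CFC.sqrt ρ) w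
  rw [hρR] at hqρ
  simp_rw [hq]
  rw [hqρ, integral_complex_ofReal, Complex.real_smul,
    ← Complex.ofReal_mul, ← Complex.ofReal_sub, Complex.zero_le_real, sub_nonneg]
  set Q : Metric.sphere (0 : EuclideanSpace ℂ (ι × ι')) 1 → ℝ := fun ψ =>
    fidelity ρ (tensorPow (reducedState ψ.1) n) ^ 2 *
      ∑ y, ‖(star w ᵥ* coeffMatrix e n ψ.1) y‖ ^ 2 with hQ
  have hQ0 : 0 ≤ ∫ ψ, Q ψ ∂uniformSphere (ι × ι') :=
    integral_nonneg fun ψ => mul_nonneg (sq_nonneg _) (Finset.sum_nonneg fun _ _ => sq_nonneg _)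
  have hQc : Continuous Q :=
    (hF.pow 2).mul (continuous_finsetSum _ fun y _ => (hA y).norm.pow 2)
  calc ∑ y, ‖(star w ᵥ* CFC.sqrt ρ) y‖ ^ 2
      ≤ ∑ y, (N : ℝ) ^ 2 * ∫ ψ, ‖tensorPowInner (purification e ρ) ψ.1 *
          (star w ᵥ* coeffMatrix e n ψ.1) y‖ ^ 2 ∂uniformSphere (ι × ι') := by
        refine Finset.sum_le_sum fun y _ => ?_
        rw [vecMul_sqrt_eq_integral e hρ.1 hsymm, hcard, ← hN, norm_mul, mul_pow,
          Complex.norm_natCast]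
        exact mul_le_mul_of_nonneg_left (norm_integral_sq_le
          (integrable_uniformSphere (hc.mul (hA y)))
          (integrable_uniformSphere (hG y))) (sq_nonneg _)
    _ = (N : ℝ) ^ 2 * ∫ ψ, ∑ y, ‖tensorPowInner (purification e ρ) ψ.1 *
          (star w ᵥ* coeffMatrix e n ψ.1) y‖ ^ 2 ∂uniformSphere (ι × ι') := by
        rw [integral_finsetSum _ fun y _ =>
          integrable_uniformSphere (hG y), Finset.mul_sum]
    _ ≤ (N : ℝ) ^ 2 * ∫ ψ, Q ψ ∂uniformSphere (ι × ι') := by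
        refine mul_le_mul_of_nonneg_left (integral_mono
          (integrable_uniformSphere (continuous_finsetSum _ fun y _ => hG y))
          (integrable_uniformSphere hQc) fun ψ => ?_) (sq_nonneg _)
        simp only [hQ, norm_mul, mul_pow]
        rw [← Finset.mul_sum]
        exact mul_le_mul_of_nonneg_right (pow_le_pow_left₀ (norm_nonneg _)
          (norm_tensorPowInner_purification_le e ρ ψ.1) 2)
          (Finset.sum_nonneg fun _ _ => sq_nonneg _)
    -- The second power of `N ≥ 1` already suffices.
    _ ≤ (N : ℝ) ^ 3 * ∫ ψ, Q ψ ∂uniformSphere (ι × ι') :=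
        mul_le_mul_of_nonneg_right (pow_le_pow_right₀ hN1 (by norm_num)) hQ0
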